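/- Let $p\ge 1$ be an integer, and let $K\subset\mathbb{R}^3$ be a closed convex set with non-empty interior. Let $U\subset\mathbb{R}^2$ be open and let $\sigma:U\to\partial K$ be a $C^{p+2}$ parametrization $(u,v)\mapsto\sigma(u,v)$ of (a piece of) the boundary surface of $K$. Assume that $\sigma_u\times\sigma_v\neq 0$ on $U$ and that the unit normal $$\mathbf n=\frac{\sigma_u\times\sigma_v}{|\sigma_u\times\sigma_v|}$$ points into $K$, that is, for every $q\in U$ one has $\sigma(q)+s\,\mathbf n(q)\in K$ for all sufficiently small $s>0$. Let $\Sigma=(\sigma_u\,|\,\sigma_v\,|\,\mathbf n)$ be the $3\times3$ matrix with these columns, and let $W=\begin{pmatrix}a&c\\ b&d\end{pmatrix}$ be the Weingarten matrix, whose entries are defined by $\mathbf n_u=a\,\sigma_u+b\,\sigma_v$ and $\mathbf n_v=c\,\sigma_u+d\,\sigma_v$. Let $J\subset\mathbb{R}$ be an open interval containing $0$, let $c:J\to\mathbb{R}^3$ be a $C^{p+1}$ curve, and consider the differential equation $$\begin{pmatrix}\dot u\\ \dot v\\ \dot r\end{pmatrix}=\begin{pmatrix}(I-rW(u,v))^{-1}&0\\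 0&-1\end{pmatrix}\,\Sigma(u,v)^{-1}\,\dot c(t)\qquad (\ast)$$ for $t\in J$ and $(u,v,r)$ in the phase space $D=\{(u,v,r):(u,v)\in U,\ r>0\}$. Let $E$ be the set of all $(t,u_0,v_0,r_0)$ with $(u_0,v_0,r_0)\in D$ such that the initial value problem for $(\ast)$ with value $(u_0,v_0,r_0)$ at time $0$ has a solution in $D$ on some open interval $I\subset J$ that contains $0$ and $t$. Then $E$ is open in $\mathbb{R}^4$ and contains $\{0\}\times D$, and there is a map $\phi:E\to D$ (the flow) such that: 1. for each $(u_0,v_0,r_0)\in D$, the set $\{t:(t,u_0,v_0,r_0)\in E\}$ is an open interval containing $0$, and $t\mapsto\phi(t,u_0,v_0,r_0)$ is a solution of $(\ast)$ on it with value $(u_0,v_0,r_0)$ at $t=0$; 2. every solution in $D$ of $(\ast)$ on an open interval $I\subset J$, $0\in I$, with value $(u_0,v_0,r_0)$ at $t=0$, agrees with $\phi(\cdot,u_0,v_0,r_0)$ on $I$; 3. $\phi$ is $C^p$ on $E$, jointly in $(t,u_0,v_0,r_0)$. -/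

import Mathlib

open Set Filter Topology
open scoped Matrix

namespace FlyBy

/-- Euclidean three-space. -/
abbrev Space : Type := EuclideanSpace ℝ (Fin 3)

/-- Triples `(u, v, r) = (x 0, x 1, x 2)`. -/
abbrev State : Type := Fin 3 → ℝ

noncomputable section

/-- The partial derivative `∂_u f` of a function of `(u, v)`. -/
def partialU (f : ℝ × ℝ → Space) (q : ℝ × ℝ) : Space := fderiv ℝ f q (1, 0)

/-- The partial derivative `∂_v f` of a function of `(u, v)`. -/
def partialV (f : ℝ × ℝ → Space) (q : ℝ × ℝ) : Space := fderiv ℝ f q (0, 1)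

/-- The vector product `σ_u × σ_v`. -/
def crossUV (σ : ℝ × ℝ → Space) (q : ℝ × ℝ) : Space :=
  WithLp.toLp 2 (crossProduct (partialU σ q).ofLp (partialV σ q).ofLp)

/-- The unit normal `n = (σ_u × σ_v) / |σ_u × σ_v|`. -/
def unitNormal (σ : ℝ × ℝ → Space) (q : ℝ × ℝ) : Space :=
  ‖crossUV σ q‖⁻¹ • crossUV σ q

/-- The matrix `Σ` with columns `σ_u`, `σ_v`, `n`. -/
def frameMatrix (σ : ℝ × ℝ → Space) (q : ℝ × ℝ) : Matrix (Fin 3) (Fin 3) ℝ :=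
  Matrix.of fun i j => ![partialU σ q i, partialV σ q i, unitNormal σ q i] j

/-- The Weingarten matrix `W`: its columns hold the coefficients of `n_u` and of `n_v` with respect
to `σ_u, σ_v`, read off in the frame `(σ_u, σ_v, n)`; see `weingarten_eq`. -/
def weingarten (σ : ℝ × ℝ → Space) (q : ℝ × ℝ) : Matrix (Fin 2) (Fin 2) ℝ :=
  Matrix.of fun i j =>
    ((frameMatrix σ q)⁻¹ *ᵥ
      (![partialU (unitNormal σ) q, partialV (unitNormal σ) q] j).ofLp) i.castSucc

theorem norm_unitNormal {σ : ℝ × ℝ → Space} {q : ℝ × ℝ} (h : crossUV σ q ≠ 0) :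
    ‖unitNormal σ q‖ = 1 := by
  rw [unitNormal, norm_smul, norm_inv, norm_norm, inv_mul_cancel₀ (norm_ne_zero_iff.mpr h)]

theorem det_frameMatrix (σ : ℝ × ℝ → Space) (q : ℝ × ℝ) :
    (frameMatrix σ q).det = ‖crossUV σ q‖ := by
  have h : (frameMatrix σ q).det = ‖crossUV σ q‖⁻¹ * ‖crossUV σ q‖ ^ 2 := by
    rw [EuclideanSpace.norm_sq_eq, Matrix.det_fin_three]
    simp [frameMatrix, unitNormal, crossUV, cross_apply, Fin.sum_univ_three]
    ring
  rw [h]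
  by_cases h0 : ‖crossUV σ q‖ = 0
  · simp [h0]
  · field_simp

/-- The Weingarten equations `n_u = a σ_u + b σ_v`, `n_v = c σ_u + d σ_v` with
`W = (a c; b d)`. -/
theorem weingarten_eq {σ : ℝ × ℝ → Space} {q : ℝ × ℝ}
    (hreg : ∀ᶠ q' in 𝓝 q, crossUV σ q' ≠ 0) (hn : DifferentiableAt ℝ (unitNormal σ) q) :
    partialU (unitNormal σ) q =
        weingarten σ q 0 0 • partialU σ q + weingarten σ q 1 0 • partialV σ q ∧
      partialV (unitNormal σ) q =
        weingarten σ q 0 1 • partialU σ q + weingarten σ q 1 1 • partialV σ q := by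
  have h0 : crossUV σ q ≠ 0 := hreg.self_of_nhds
  have hdet : IsUnit (frameMatrix σ q).det := by
    rw [det_frameMatrix]
    exact (norm_ne_zero_iff.mpr h0).isUnit
  have hperp : ∀ w : ℝ × ℝ, inner ℝ (unitNormal σ q) (fderiv ℝ (unitNormal σ) q w) = 0 := by
    intro w
    have h1 : HasFDerivAt (fun q' => ‖unitNormal σ q'‖ ^ 2) _ q := hn.hasFDerivAt.norm_sq
    have h2 : (fun q' => ‖unitNormal σ q'‖ ^ 2) =ᶠ[𝓝 q] fun _ => (1 : ℝ) := by
      filter_upwards [hreg] with q' hq'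
      rw [norm_unitNormal hq', one_pow]
    have h3 := h1.unique ((hasFDerivAt_const (1 : ℝ) q).congr_of_eventuallyEq h2)
    have h4 := DFunLike.congr_fun h3 w
    simpa using h4
  have hcoord : ∀ y : Space, inner ℝ (unitNormal σ q) y = 0 →
      y = ((frameMatrix σ q)⁻¹ *ᵥ y.ofLp) 0 • partialU σ q +
        ((frameMatrix σ q)⁻¹ *ᵥ y.ofLp) 1 • partialV σ q := by
    intro y hy
    set a := (frameMatrix σ q)⁻¹ *ᵥ y.ofLp with ha
    have hmul : frameMatrix σ q *ᵥ a = y.ofLp := by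
      rw [ha, Matrix.mulVec_mulVec, Matrix.mul_nonsing_inv _ hdet, Matrix.one_mulVec]
    have hsum : y = a 0 • partialU σ q + a 1 • partialV σ q + a 2 • unitNormal σ q := by
      ext i
      have := congrFun hmul i
      simp only [Matrix.mulVec, dotProduct, Fin.sum_univ_three, frameMatrix, Matrix.of_apply,
        Matrix.cons_val] at this
      rw [← this]
      simp only [PiLp.add_apply, PiLp.smul_apply, smul_eq_mul]
      ring
    have hu : inner ℝ (unitNormal σ q) (partialU σ q) = 0 := by
      simp [PiLp.inner_apply, unitNormal, crossUV, cross_apply, Fin.sum_univ_three]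
      ring
    have hv : inner ℝ (unitNormal σ q) (partialV σ q) = 0 := by
      simp [PiLp.inner_apply, unitNormal, crossUV, cross_apply, Fin.sum_univ_three]
      ring
    have ha2 : a 2 = 0 := by
      rw [hsum, inner_add_right, inner_add_right, inner_smul_right, inner_smul_right,
        inner_smul_right, hu, hv, real_inner_self_eq_norm_sq, norm_unitNormal h0] at hy
      simpa using hy
    simpa [ha2] using hsum
  exact ⟨hcoord _ (hperp _), hcoord _ (hperp _)⟩

/-- The right-hand side `((I - r W)⁻¹ ⊕ (-1)) Σ⁻¹ ċ(t)` of the differential equation for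
`(u, v, r)`. -/
def rhs (σ : ℝ × ℝ → Space) (c : ℝ → Space) (t : ℝ) (x : State) : State :=
  (Matrix.reindex finSumFinEquiv finSumFinEquiv
      (Matrix.fromBlocks (1 - x 2 • weingarten σ (x 0, x 1))⁻¹ 0 0
        (-1 : Matrix (Fin 1) (Fin 1) ℝ)) : Matrix (Fin 3) (Fin 3) ℝ) *ᵥ
    ((frameMatrix σ (x 0, x 1))⁻¹ *ᵥ (deriv c t).ofLp)

/-- The phase space: `(u, v)` in the parameter domain `U` and `r > 0`. -/
def phaseSpace (U : Set (ℝ × ℝ)) : Set State := {x | (x 0, x 1) ∈ U ∧ 0 < x 2}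

/-- `γ` restricted to the open interval `I ∋ 0`, `I ⊆ J`, solves `ẋ = f (t, x)` inside `D`, with
`γ 0 = x₀`. -/
structure IsSolution (f : ℝ → State → State) (J : Set ℝ) (D : Set State) (x₀ : State)
    (γ : ℝ → State) (I : Set ℝ) : Prop where
  isOpen : IsOpen I
  ordConnected : I.OrdConnected
  zero_mem : (0 : ℝ) ∈ I
  subset : I ⊆ J
  mapsTo : MapsTo γ I D
  integralCurve : IsIntegralCurveOn γ f I
  initial : γ 0 = x₀

/-- The domain of the flow: all `(t, x₀)` such that the initial value problem `ẋ = f (t, x)`,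
`x 0 = x₀`, has a solution in `D` up to (and a little beyond) time `t`. -/
def flowDomain (f : ℝ → State → State) (J : Set ℝ) (D : Set State) : Set (ℝ × State) :=
  {z | ∃ γ I, IsSolution f J D z.2 γ I ∧ z.1 ∈ I}

end

end FlyBy

/-!
The flow is obtained from the implicit function theorem in a space of continuous functions.

For `β` and `ξ` as parameters, the problem `y' = β F (β s, y)`, `y 0 = ξ` on a compact interval
`[a, b] ∋ 0` is the integral equation `y - ξ - β ∫₀ˢ F (β τ, y τ) dτ = 0` in `C([a, b], E)`. Its left
side is as smooth as `F`, because the superposition operator `y ↦ F ∘ y` is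
(`contDiffOn_superposition`), and its derivative in `y` is the identity minus a Volterra operator,
which is invertible since Volterra operators are quasinilpotent (`isUnit_one_sub_volterra_comp`).
Hence solutions persist near a given one and depend smoothly on `(β, ξ)`
(`exists_smooth_solution_family`).

The parameter `β` rescales time. With `β = 1` and an interval around `0` and `t` the domain of the
flow is seen to be open; with `β` near `0` a solution through each initial value appears, as constants
solve the problem for `β = 0`; and on `[0, 1]` with `β = t` the flow `φ (t, ξ)` is the value at the fixed
time `1` of a solution that depends smoothly on the parameters `(t, ξ)`, so that it is smooth in all
variables jointly. Uniqueness is Grönwall's inequality.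

It remains to see that the right-hand side is `C^p`, that is, that `I - r W` is invertible for
`r > 0`. The inward normal is normal to a supporting plane, so `⟨n(q), y - σ(q)⟩ ≥ 0` on `K`
(`inner_unitNormal_sub_nonneg`). Adding this inequality for two points of the surface gives
`⟨σ(q') - σ(q), n(q') - n(q)⟩ ≤ 0`, hence `⟨dσ w, dn w⟩ ≤ 0` for every `w`. If `w = r W w`, then
`dσ w = r dn w`, so `|dσ w|² ≤ 0` and `w = 0` (`isUnit_det_one_sub_smul_weingarten`).
-/

namespace FlyBy

/-! ### Superposition operators between spaces of continuous functions -/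

section Superposition

variable {K V F : Type*} [TopologicalSpace K] [NormedAddCommGroup V] [NormedAddCommGroup F]

open Classical in
/-- The superposition (Nemytskii) operator `x ↦ g ∘ x` on continuous functions, with the value `0`
where `g ∘ x` is not continuous. -/
noncomputable def superposition (g : V → F) (x : C(K, V)) : C(K, F) :=
  if h : Continuous (g ∘ x) then ⟨g ∘ x, h⟩ else 0

theorem superposition_apply {g : V → F} {Ω : Set V} (hg : ContinuousOn g Ω) {x : C(K, V)}
    (hx : ∀ k, x k ∈ Ω) (k : K) : superposition g x k = g (x k) := by
  rw [superposition, dif_pos (hg.comp_continuous x.continuous hx)]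
  rfl

theorem isOpen_setOf_forall_apply_mem [CompactSpace K] {Ω : Set V} (hΩ : IsOpen Ω) :
    IsOpen {x : C(K, V) | ∀ k, x k ∈ Ω} := by
  have := ContinuousMap.isOpen_setOfPred_mapsTo (X := K) isCompact_univ hΩ
  simpa [MapsTo] using this

theorem continuousOn_superposition {g : V → F} {Ω : Set V} (hg : ContinuousOn g Ω) :
    ContinuousOn (superposition g) {x : C(K, V) | ∀ k, x k ∈ Ω} := by
  rw [continuousOn_iff_continuous_domRestrict]
  let r : {x : C(K, V) | ∀ k, x k ∈ Ω} → C(K, Ω) := fun x =>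
    ⟨fun k => ⟨x.1 k, x.2 k⟩, x.1.continuous.subtype_mk _⟩
  have hr : Continuous r :=
    (ContinuousMap.isInducing_postcomp (X := K) ⟨((↑) : Ω → V), continuous_subtype_val⟩
      IsInducing.subtypeVal).continuous_iff.2 continuous_subtype_val
  have h := (ContinuousMap.continuous_postcomp (X := K)
    ⟨Ω.domRestrict g, hg.domRestrict⟩).comp hr
  convert h using 1
  ext x k
  exact superposition_apply hg x.2 k

variable [CompactSpace K] [NormedSpace ℝ V] [NormedSpace ℝ F]

variable (K V F) in
/-- Pointwise application of a continuous family of continuous linear maps. -/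
noncomputable def pointwiseApply : C(K, V →L[ℝ] F) →L[ℝ] C(K, V) →L[ℝ] C(K, F) :=
  LinearMap.mkContinuous₂
    (LinearMap.mk₂ ℝ (fun (A : C(K, V →L[ℝ] F)) (h : C(K, V)) =>
        (⟨fun k => A k (h k), A.continuous.clm_apply h.continuous⟩ : C(K, F)))
      (fun _ _ _ => by ext; simp) (fun _ _ _ => by ext; simp)
      (fun _ _ _ => by ext; simp) (fun _ _ _ => by ext; simp)) 1 fun A h => by
    rw [ContinuousMap.norm_le _ (by positivity), one_mul]
    intro k
    exact (A k).le_of_opNorm_le_of_le (A.norm_coe_le_norm k) (h.norm_coe_le_norm k)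

@[simp]
theorem pointwiseApply_apply (A : C(K, V →L[ℝ] F)) (h : C(K, V)) (k : K) :
    pointwiseApply K V F A h k = A k (h k) := rfl

/-- The superposition operator of a `C^1` function is differentiable: the mean value inequality on
segments turns uniform closeness of the derivatives along `x` into a uniform remainder estimate. -/
theorem hasFDerivAt_superposition {g : V → F} {Ω : Set V} (hΩ : IsOpen Ω)
    (hg : ContDiffOn ℝ 1 g Ω) {x : C(K, V)} (hx : ∀ k, x k ∈ Ω) :
    HasFDerivAt (superposition g) (pointwiseApply K V F (superposition (fderiv ℝ g) x)) x := by
  have hg' : ContinuousOn (fderiv ℝ g) Ω := hg.continuousOn_fderiv_of_isOpen hΩ le_rfl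
  rw [hasFDerivAt_iff_isLittleO, Asymptotics.isLittleO_iff]
  intro ε hε
  have hO := (isOpen_setOf_forall_apply_mem (K := K) hΩ)
  have hc := (continuousOn_superposition (K := K) hg').continuousAt (hO.mem_nhds hx)
  have hxΩ : ∀ᶠ y in 𝓝 x, ∀ k, y k ∈ Ω := hO.mem_nhds hx
  obtain ⟨δ, hδ, hball⟩ := Metric.eventually_nhds_iff_ball.1
    (hxΩ.and (Metric.tendsto_nhds.1 hc ε hε))
  filter_upwards [Metric.ball_mem_nhds x hδ] with y hy
  rw [ContinuousMap.norm_le _ (by positivity)]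
  intro k
  -- A point of the segment from `x k` to `y k` is the value at `k` of a function of the ball.
  have hseg : ∀ z ∈ segment ℝ (x k) (y k), z ∈ Ω ∧ ‖fderiv ℝ g z - fderiv ℝ g (x k)‖ ≤ ε := by
    rintro _ ⟨α, β, hα, hβ, hαβ, rfl⟩
    have hw : α • x + β • y ∈ Metric.ball x δ :=
      (convex_ball x δ) (Metric.mem_ball_self hδ) hy hα hβ hαβ
    obtain ⟨h1, h2⟩ := hball _ hw
    refine ⟨h1 k, ?_⟩
    have h3 := ((ContinuousMap.dist_lt_iff hε).1 h2 k).le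
    rwa [superposition_apply hg' h1, superposition_apply hg' hx, dist_eq_norm] at h3
  have hmv := (convex_segment (x k) (y k)).norm_image_sub_le_of_norm_hasFDerivWithin_le'
    (𝕜 := ℝ) (f := g) (f' := fderiv ℝ g)
    (fun z hz => ((hg.contDiffAt (hΩ.mem_nhds (hseg z hz).1)).differentiableAt
      one_ne_zero).hasFDerivAt.hasFDerivWithinAt)
    (fun z hz => (hseg z hz).2) (left_mem_segment ℝ _ _) (right_mem_segment ℝ _ _)
  have hxy : ‖y k - x k‖ ≤ ‖y - x‖ := (y - x).norm_coe_le_norm k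
  have hyΩ := (hball y hy).1
  simp only [ContinuousMap.sub_apply, pointwiseApply_apply,
    superposition_apply hg.continuousOn hx, superposition_apply hg.continuousOn hyΩ,
    superposition_apply hg' hx]
  exact hmv.trans (by gcongr)

/-- The superposition operator of a `C^n` function is `C^n`: its derivative is the superposition
operator of the derivative, followed by pointwise application. -/
theorem contDiffOn_superposition.{u} {K : Type*} {V F : Type u} [TopologicalSpace K]
    [CompactSpace K] [NormedAddCommGroup V] [NormedSpace ℝ V] [NormedAddCommGroup F] [NormedSpace ℝ F]
    {g : V → F} {Ω : Set V} (hΩ : IsOpen Ω) {n : ℕ}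
    (hg : ContDiffOn ℝ n g Ω) :
    ContDiffOn ℝ n (superposition g) {x : C(K, V) | ∀ k, x k ∈ Ω} := by
  have hO := (isOpen_setOf_forall_apply_mem (K := K) hΩ)
  induction n generalizing F with
  | zero =>
    exact contDiffOn_zero.2 (continuousOn_superposition hg.continuousOn)
  | succ n ih =>
    rw [Nat.cast_succ] at hg ⊢
    have h1 : ContDiffOn ℝ 1 g Ω := hg.of_le (by norm_cast; omega)
    rw [contDiffOn_succ_iff_hasFDerivWithinAt_of_uniqueDiffOn hO.uniqueDiffOn]
    refine ⟨by simp, fun x => pointwiseApply K V F (superposition (fderiv ℝ g) x), ?_,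
      fun x hx => (hasFDerivAt_superposition hΩ h1 hx).hasFDerivWithinAt⟩
    exact (pointwiseApply K V F).contDiff.comp_contDiffOn
      (ih (hg.fderiv_of_isOpen hΩ le_rfl))

end Superposition

/-! ### Volterra operators -/

section Volterra

variable {E : Type*} [NormedAddCommGroup E] {a b : ℝ}

theorem continuous_IccExtend (hab : a ≤ b) (h : C(Icc a b, E)) : Continuous (IccExtend hab h) :=
  (ContinuousMap.IccExtend hab h).continuous

variable [NormedSpace ℝ E]

/-- The integration operator `h ↦ ∫₀ˢ h` on continuous functions on `[a, b] ∋ 0`. -/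
noncomputable def volterra (ha : a ≤ 0) (hb : 0 ≤ b) : C(Icc a b, E) →L[ℝ] C(Icc a b, E) :=
  LinearMap.mkContinuous
    { toFun := fun h => ⟨fun s => ∫ τ in (0 : ℝ)..s, IccExtend (ha.trans hb) h τ,
        (intervalIntegral.continuous_primitive
          (fun _ _ => (continuous_IccExtend _ h).intervalIntegrable _ _) 0).comp
          continuous_subtype_val⟩
      map_add' := fun h k => by
        ext s
        exact intervalIntegral.integral_add
          ((continuous_IccExtend _ h).intervalIntegrable _ _)
          ((continuous_IccExtend _ k).intervalIntegrable _ _)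
      map_smul' := fun r h => by
        ext s
        exact intervalIntegral.integral_smul r (IccExtend (ha.trans hb) h) }
    (max |a| |b|) fun h => by
      rw [ContinuousMap.norm_le _ (by positivity)]
      intro s
      have h1 : ∀ τ ∈ uIoc 0 (s : ℝ), ‖IccExtend (ha.trans hb) h τ‖ ≤ ‖h‖ :=
        fun τ _ => h.norm_coe_le_norm _
      have h2 : |(s : ℝ)| ≤ max |a| |b| := abs_le_max_abs_abs s.2.1 s.2.2
      refine (intervalIntegral.norm_integral_le_of_norm_le_const h1).trans ?_
      rw [sub_zero, mul_comm]
      gcongr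

theorem volterra_apply (ha : a ≤ 0) (hb : 0 ≤ b) (h : C(Icc a b, E)) (s : Icc a b) :
    volterra ha hb h s = ∫ τ in (0 : ℝ)..s, IccExtend (ha.trans hb) h τ := rfl

/-- The iterates of a Volterra operator obey the factorial bound that makes it quasinilpotent. -/
theorem norm_pow_volterra_comp_apply_le (ha : a ≤ 0) (hb : 0 ≤ b)
    {B : C(Icc a b, E) →L[ℝ] C(Icc a b, E)} {M : ℝ} (hM : 0 ≤ M)
    (hB : ∀ h s, ‖B h s‖ ≤ M * ‖h s‖) (n : ℕ) (h : C(Icc a b, E)) (s : Icc a b) :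
    ‖((volterra ha hb ∘L B) ^ n) h s‖ ≤ M ^ n * |(s : ℝ)| ^ n / n.factorial * ‖h‖ := by
  induction n generalizing s with
  | zero => simpa using h.norm_coe_le_norm s
  | succ n ih =>
    rw [pow_succ']
    change ‖∫ τ in (0 : ℝ)..s,
      IccExtend (ha.trans hb) (B (((volterra ha hb ∘L B) ^ n) h)) τ‖ ≤ _
    refine (intervalIntegral.norm_integral_le_integral_norm_uIoc).trans ?_
    have hmono : ∫ τ in uIoc 0 (s : ℝ),
          ‖IccExtend (ha.trans hb) (B (((volterra ha hb ∘L B) ^ n) h)) τ‖ ≤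
        ∫ τ in uIoc 0 (s : ℝ), M ^ (n + 1) / n.factorial * ‖h‖ * |τ - 0| ^ n := by
      refine MeasureTheory.setIntegral_mono_on ?_ ?_ measurableSet_uIoc fun τ hτ => ?_
      · exact (continuous_IccExtend _ _).norm.integrableOn_uIoc
      · exact Continuous.integrableOn_uIoc (by fun_prop)
      · have hτ' : τ ∈ Icc a b :=
          (uIoc_subset_uIcc.trans (uIcc_subset_Icc ⟨ha, hb⟩ s.2)) hτ
        rw [IccExtend_of_mem _ _ hτ', sub_zero]
        refine (hB _ _).trans ((mul_le_mul_of_nonneg_left (ih ⟨τ, hτ'⟩) hM).trans_eq ?_)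
        ring
    refine hmono.trans_eq ?_
    rw [MeasureTheory.integral_const_mul, integral_pow_abs_sub_uIoc, sub_zero,
      Nat.factorial_succ, Nat.cast_mul]
    push_cast
    field_simp

theorem isUnit_one_sub_volterra_comp [CompleteSpace E] (ha : a ≤ 0) (hb : 0 ≤ b)
    {B : C(Icc a b, E) →L[ℝ] C(Icc a b, E)} {M : ℝ} (hM : 0 ≤ M)
    (hB : ∀ h s, ‖B h s‖ ≤ M * ‖h s‖) :
    IsUnit (1 - volterra ha hb ∘L B) := by
  set T := volterra ha hb ∘L B
  set R := M * max |a| |b|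
  obtain ⟨n, hn⟩ : ∃ n : ℕ, R ^ n / n.factorial < 1 :=
    ((FloorSemiring.tendsto_pow_div_factorial_atTop R).eventually_lt_const one_pos).exists
  have hnorm : ‖T ^ n‖ < 1 := by
    refine (ContinuousLinearMap.opNorm_le_bound _ (by positivity) fun h => ?_).trans_lt hn
    rw [ContinuousMap.norm_le _ (by positivity)]
    intro s
    refine (norm_pow_volterra_comp_apply_le ha hb hM hB n h s).trans ?_
    rw [← mul_pow]
    change _ ≤ (M * max |a| |b|) ^ n / n.factorial * ‖h‖
    have h2 : |(s : ℝ)| ≤ max |a| |b| := abs_le_max_abs_abs s.2.1 s.2.2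
    gcongr
  have h1 := isUnit_one_sub_of_norm_lt_one (R := C(Icc a b, E) →L[ℝ] C(Icc a b, E)) hnorm
  rw [← mul_neg_geom_sum T n] at h1
  refine (Commute.isUnit_mul_iff ?_).1 h1 |>.1
  exact (Commute.sum_right _ _ _ fun i _ =>
    (Commute.one_left _).sub_left (Commute.self_pow T i))

end Volterra

/-! ### Smooth families of solutions on a compact interval -/

section SolutionFamily

variable {E : Type*} [NormedAddCommGroup E] [NormedSpace ℝ E] {a b : ℝ}

variable (E a b) in
/-- The linear map sending `(β, y)` to the rescaled graph `s ↦ (β s, y s)` of `y`. -/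
noncomputable def rescaledGraph : ℝ × C(Icc a b, E) →L[ℝ] C(Icc a b, ℝ × E) :=
  (ContinuousLinearMap.fst ℝ ℝ C(Icc a b, E)).smulRight
      (⟨fun s => ((s : ℝ), 0), by fun_prop⟩ : C(Icc a b, ℝ × E)) +
    ((ContinuousLinearMap.inr ℝ ℝ E).compLeftContinuous ℝ (Icc a b)) ∘L
      ContinuousLinearMap.snd ℝ ℝ C(Icc a b, E)

@[simp]
theorem rescaledGraph_apply (z : ℝ × C(Icc a b, E)) (s : Icc a b) :
    rescaledGraph E a b z s = (z.1 * s, z.2 s) := by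
  simp [rescaledGraph]

/-- The residual `y - ξ - β ∫₀ˢ F (β τ, y τ) dτ` of the integral equation equivalent to
`y' = β F (β s, y)`, `y 0 = ξ`. -/
noncomputable def residual (ha : a ≤ 0) (hb : 0 ≤ b) (F : ℝ × E → E)
    (z : (ℝ × E) × C(Icc a b, E)) : C(Icc a b, E) :=
  z.2 - ContinuousLinearMap.const ℝ (Icc a b) z.1.2 -
    z.1.1 • volterra ha hb (superposition F (rescaledGraph E a b (z.1.1, z.2)))

variable {F : ℝ × E → E} {Ω : Set (ℝ × E)}

theorem contDiffAt_residual (ha : a ≤ 0) (hb : 0 ≤ b) (hΩ : IsOpen Ω) {n : ℕ}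
    (hF : ContDiffOn ℝ n F Ω) {z : (ℝ × E) × C(Icc a b, E)}
    (hz : ∀ s : Icc a b, (z.1.1 * s, z.2 s) ∈ Ω) :
    ContDiffAt ℝ n (residual ha hb F) z := by
  have hsup : ContDiffAt ℝ n (superposition (K := Icc a b) F)
      (rescaledGraph E a b (z.1.1, z.2)) :=
    (contDiffOn_superposition hΩ hF).contDiffAt
      ((isOpen_setOf_forall_apply_mem hΩ).mem_nhds fun s => by simpa using hz s)
  have hcomp : ContDiffAt ℝ n (fun z : (ℝ × E) × C(Icc a b, E) =>
      superposition F (rescaledGraph E a b (z.1.1, z.2))) z :=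
    ContDiffAt.comp (f := fun z : (ℝ × E) × C(Icc a b, E) =>
      rescaledGraph E a b (z.1.1, z.2)) z hsup (by fun_prop)
  unfold residual
  fun_prop

/-- The partial derivative of the residual in `y` is the identity minus a Volterra operator, hence
invertible. -/
theorem isInvertible_fderiv_residual_comp_inr [CompleteSpace E] (ha : a ≤ 0) (hb : 0 ≤ b)
    (hΩ : IsOpen Ω) (hF : ContDiffOn ℝ 1 F Ω) {z : (ℝ × E) × C(Icc a b, E)}
    (hz : ∀ s : Icc a b, (z.1.1 * s, z.2 s) ∈ Ω) :
    (fderiv ℝ (residual ha hb F) z ∘L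
      .inr ℝ (ℝ × E) C(Icc a b, E)).IsInvertible := by
  obtain ⟨⟨β, ξ⟩, y⟩ := z
  set x := rescaledGraph E a b (β, y)
  have hx : ∀ s, x s ∈ Ω := fun s => by simpa [x] using hz s
  set A := superposition (fderiv ℝ F) x
  set B : C(Icc a b, E) →L[ℝ] C(Icc a b, E) :=
    β • (pointwiseApply (Icc a b) (ℝ × E) E A ∘L
      (rescaledGraph E a b ∘L .inr ℝ ℝ C(Icc a b, E)))
  have hB : ∀ h s, ‖B h s‖ ≤ |β| * ‖A‖ * ‖h s‖ := by
    intro h s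
    have h1 : B h s = β • A s (0, h s) := by simp [B]
    rw [h1, norm_smul, Real.norm_eq_abs, mul_assoc]
    gcongr
    refine (A s).le_of_opNorm_le_of_le (A.norm_coe_le_norm s) ?_
    simp
  have hunit := isUnit_one_sub_volterra_comp ha hb (by positivity) hB
  have hd1 : HasFDerivAt (fun y' => residual ha hb F ((β, ξ), y'))
      (fderiv ℝ (residual ha hb F) ((β, ξ), y) ∘L .inr ℝ (ℝ × E) C(Icc a b, E)) y := by
    have h1 := ((contDiffAt_residual (n := 1) ha hb hΩ (by exact_mod_cast hF)
      hz).differentiableAt (by simp)).hasFDerivAt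
    exact h1.comp y (hasFDerivAt_prodMk_right (β, ξ) y)
  have hd2 : HasFDerivAt (fun y' => residual ha hb F ((β, ξ), y'))
      (1 - volterra ha hb ∘L B) y := by
    have h1 := (hasFDerivAt_superposition hΩ hF hx).comp y
      ((rescaledGraph E a b).hasFDerivAt.comp y (hasFDerivAt_prodMk_right β y))
    have h2 := ((hasFDerivAt_id y).sub_const (ContinuousLinearMap.const ℝ (Icc a b) ξ)).sub
      (((volterra ha hb).hasFDerivAt.comp y h1).const_smul β)
    refine h2.congr_fderiv ?_
    ext h s
    simp [B, A]
  rw [hd1.unique hd2]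
  obtain ⟨w, hw⟩ := hunit
  exact ⟨ContinuousLinearEquiv.ofUnit w, hw⟩

/-- Smooth dependence on the time scale and on the initial value: near a solution on `[a, b] ∋ 0`
of `y' = β₀ F (β₀ s, y)`, `y 0 = ξ₀`, the problems with parameters `(β, ξ)` have solutions `Y (β, ξ)`
on `[a, b]`, and their values at each time are as smooth in `(β, ξ)` as `F` is. -/
theorem exists_smooth_solution_family [CompleteSpace E] (ha : a ≤ 0) (hb : 0 ≤ b)
    (hΩ : IsOpen Ω) {n : ℕ} (hn : 1 ≤ n) (hF : ContDiffOn ℝ n F Ω) {β₀ : ℝ} {γ : ℝ → E}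
    (hγΩ : ∀ s ∈ Icc a b, (β₀ * s, γ s) ∈ Ω)
    (hγ : ∀ s ∈ Icc a b, HasDerivAt γ (β₀ • F (β₀ * s, γ s)) s) :
    ∃ Y : ℝ × E → ℝ → E,
      (∀ᶠ z in 𝓝 (β₀, γ 0), Y z 0 = z.2 ∧ ∀ s ∈ Icc a b, (z.1 * s, Y z s) ∈ Ω ∧
        HasDerivAt (Y z) (z.1 • F (z.1 * s, Y z s)) s) ∧
      ∀ s ∈ Icc a b, ContDiffAt ℝ n (fun z => Y z s) (β₀, γ 0) := by
  have hab := ha.trans hb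
  let y₀ : C(Icc a b, E) := ⟨fun s => γ s, continuous_iff_continuousAt.2 fun s =>
    (hγ s s.2).continuousAt.comp continuous_subtype_val.continuousAt⟩
  set u : (ℝ × E) × C(Icc a b, E) := ((β₀, γ 0), y₀)
  have hu : ∀ s : Icc a b, (u.1.1 * s, u.2 s) ∈ Ω := fun s => hγΩ s s.2
  have hF1 : ContDiffOn ℝ 1 F Ω := hF.of_le (by exact_mod_cast hn)
  have hcd := contDiffAt_residual ha hb hΩ hF hu
  have hn0 : (n : WithTop ℕ∞) ≠ 0 := by exact_mod_cast (Nat.one_le_iff_ne_zero.1 hn)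
  have hinv := isInvertible_fderiv_residual_comp_inr ha hb hΩ hF1 hu
  have hu0 : residual ha hb F u = 0 := by
    ext s
    have hint : ∫ τ in (0 : ℝ)..s, β₀ • IccExtend hab
        (superposition F (rescaledGraph E a b (β₀, y₀))) τ = γ s - γ 0 := by
      refine intervalIntegral.integral_eq_sub_of_hasDerivAt (fun τ hτ => ?_)
        (((continuous_IccExtend _ _).const_smul β₀).intervalIntegrable _ _)
      have hτ' : τ ∈ Icc a b := uIcc_subset_Icc ⟨ha, hb⟩ s.2 hτ
      rw [IccExtend_of_mem _ _ hτ',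
        superposition_apply hF.continuousOn (fun s => by simpa using hu s)]
      simpa [y₀] using hγ τ hτ'
    rw [intervalIntegral.integral_smul] at hint
    simp [residual, u, volterra_apply, hint, y₀]
  set ψ := hcd.implicitFunction hn0 hinv
  have hψu : ψ (β₀, γ 0) = y₀ := hcd.implicitFunction_apply_self hn0 hinv
  have hψ : ContDiffAt ℝ n ψ (β₀, γ 0) := hcd.contDiffAt_implicitFunction hn0 hinv
  -- The solution is extended off `[a, b]` by the integral formula, which makes it differentiable at
  -- the endpoints too.
  let Y : ℝ × E → ℝ → E := fun z s => z.2 + z.1 • ∫ τ in (0 : ℝ)..s,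
    IccExtend hab (superposition F (rescaledGraph E a b (z.1, ψ z))) τ
  have hYψ : ∀ᶠ z in 𝓝 (β₀, γ 0), ∀ s : Icc a b, Y z s = ψ z s := by
    filter_upwards [hcd.eventually_apply_implicitFunction hn0 hinv] with z hz s
    have h1 := DFunLike.congr_fun (hz.trans hu0) s
    simp only [residual, ContinuousMap.sub_apply, ContinuousMap.smul_apply, volterra_apply,
      ContinuousMap.zero_apply, ContinuousLinearMap.const_apply_apply] at h1
    rw [sub_sub, sub_eq_zero] at h1
    exact h1.symm
  have hmem : ∀ᶠ z in 𝓝 (β₀, γ 0), ∀ s : Icc a b, rescaledGraph E a b (z.1, ψ z) s ∈ Ω := by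
    have hcont : ContinuousAt (fun z => rescaledGraph E a b (z.1, ψ z)) (β₀, γ 0) :=
      (rescaledGraph E a b).continuous.continuousAt.comp
        (continuousAt_fst.prodMk hψ.continuousAt)
    refine hcont.eventually_mem ((isOpen_setOf_forall_apply_mem hΩ).mem_nhds fun s => ?_)
    rw [hψu]
    simpa using hu s
  refine ⟨Y, ?_, fun s hs => ?_⟩
  · filter_upwards [hYψ, hmem] with z hz hzΩ
    refine ⟨by simp [Y], fun s hs => ?_⟩
    have h1 := hz ⟨s, hs⟩
    have h2 := hzΩ ⟨s, hs⟩
    simp only [rescaledGraph_apply, ← h1] at h2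
    refine ⟨h2, ?_⟩
    have h3 := ((continuous_IccExtend hab (superposition F
      (rescaledGraph E a b (z.1, ψ z)))).integral_hasStrictDerivAt 0 s).hasDerivAt
    have h4 := (h3.const_smul z.1).const_add z.2
    rw [IccExtend_of_mem _ _ hs, superposition_apply hF.continuousOn hzΩ, rescaledGraph_apply,
      ← h1] at h4
    exact h4
  · have h1 : ContDiffAt ℝ n (fun z => ψ z ⟨s, hs⟩) (β₀, γ 0) :=
      (ContinuousMap.evalCLM (M := E) ℝ (⟨s, hs⟩ : Icc a b)).contDiff.contDiffAt.comp _ hψ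
    exact h1.congr_of_eventuallyEq (hYψ.mono fun z hz => hz ⟨s, hs⟩)

end SolutionFamily

/-! ### Uniqueness of solutions -/

section Uniqueness

variable {E : Type*} [NormedAddCommGroup E] [NormedSpace ℝ E] {F : ℝ × E → E} {Ω : Set (ℝ × E)}

/-- Two solutions on `[0, 1]` of the problem with time scale `β` that agree at `0` are equal. The
derivatives are two-sided at the endpoints as well. -/
theorem eqOn_Icc_of_hasDerivAt_rescaled (hΩ : IsOpen Ω) (hF : ContDiffOn ℝ 1 F Ω) {β : ℝ}
    {y₁ y₂ : ℝ → E}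
    (h₁ : ∀ s ∈ Icc (0 : ℝ) 1, (β * s, y₁ s) ∈ Ω ∧ HasDerivAt y₁ (β • F (β * s, y₁ s)) s)
    (h₂ : ∀ s ∈ Icc (0 : ℝ) 1, (β * s, y₂ s) ∈ Ω ∧ HasDerivAt y₂ (β • F (β * s, y₂ s)) s)
    (h0 : y₁ 0 = y₂ 0) : EqOn y₁ y₂ (Icc 0 1) := by
  have hc₁ : ContinuousOn y₁ (Icc 0 1) := HasDerivAt.continuousOn fun s hs => (h₁ s hs).2
  have hc₂ : ContinuousOn y₂ (Icc 0 1) := HasDerivAt.continuousOn fun s hs => (h₂ s hs).2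
  have hclosed : IsClosed ({s | y₁ s = y₂ s} ∩ Icc (0 : ℝ) 1) := by
    rw [inter_comm]
    exact (hc₁.prodMk hc₂).preimage_isClosed_of_isClosed isClosed_Icc isClosed_diagonal
  refine hclosed.Icc_subset_of_forall_mem_nhdsWithin h0 ?_
  rintro x ⟨hx, hx01⟩
  have hxI : x ∈ Icc (0 : ℝ) 1 := Ico_subset_Icc_self hx01
  obtain ⟨K, T, hT, hlip⟩ :=
    (hF.contDiffAt (hΩ.mem_nhds (h₁ x hxI).1)).exists_lipschitzOnWith
  have hev₁ : ∀ᶠ s in 𝓝 x, (β * s, y₁ s) ∈ T := by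
    have : ContinuousAt (fun s => (β * s, y₁ s)) x :=
      (by fun_prop : ContinuousAt (fun s : ℝ => β * s) x).prodMk (h₁ x hxI).2.continuousAt
    exact this.eventually_mem hT
  have hev₂ : ∀ᶠ s in 𝓝 x, (β * s, y₂ s) ∈ T := by
    have : ContinuousAt (fun s => (β * s, y₂ s)) x :=
      (by fun_prop : ContinuousAt (fun s : ℝ => β * s) x).prodMk (h₂ x hxI).2.continuousAt
    refine this.eventually_mem ?_
    rwa [← (show y₁ x = y₂ x from hx)]
  obtain ⟨ε, hε, hball⟩ := Metric.eventually_nhds_iff_ball.1 (hev₁.and hev₂)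
  obtain ⟨c, hxc, hc⟩ : ∃ c, x < c ∧ c < min 1 (x + ε) :=
    exists_between (lt_min hx01.2 (by linarith))
  have hcI : Icc x c ⊆ Icc 0 1 :=
    Icc_subset_Icc hx01.1 (hc.le.trans (min_le_left _ _))
  have hcT : ∀ s ∈ Icc x c, (β * s, y₁ s) ∈ T ∧ (β * s, y₂ s) ∈ T := by
    intro s hs
    refine hball s ?_
    rw [Real.ball_eq_Ioo]
    exact ⟨by linarith [hs.1], hs.2.trans_lt (hc.trans_le (min_le_right _ _))⟩
  have heq : EqOn y₁ y₂ (Icc x c) := by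
    refine ODE_solution_unique_of_mem_Icc_right (v := fun s y => β • F (β * s, y))
      (s := fun s => {y | (β * s, y) ∈ T}) (K := ‖β‖₊ * K) (fun s _ => ?_)
      (hc₁.mono hcI)
      (fun s hs => (h₁ s (hcI (Ico_subset_Icc_self hs))).2.hasDerivWithinAt)
      (fun s hs => (hcT s (Ico_subset_Icc_self hs)).1)
      (hc₂.mono hcI)
      (fun s hs => (h₂ s (hcI (Ico_subset_Icc_self hs))).2.hasDerivWithinAt)
      (fun s hs => (hcT s (Ico_subset_Icc_self hs)).2) hx
    refine LipschitzOnWith.of_dist_le_mul fun y hy y' hy' => ?_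
    rw [dist_smul₀, NNReal.coe_mul, coe_nnnorm, mul_assoc]
    gcongr
    refine (hlip.dist_le_mul _ hy _ hy').trans_eq ?_
    rw [Prod.dist_eq, dist_self, max_eq_right dist_nonneg]
  exact mem_of_superset (Icc_mem_nhdsGT hxc) heq

end Uniqueness

/-! ### The flow of a non-autonomous differential equation -/

section Flow

variable {f : ℝ → State → State} {J : Set ℝ} {D : Set State}

theorem IsSolution.hasDerivAt {x₀ : State} {γ : ℝ → State} {I : Set ℝ}
    (h : IsSolution f J D x₀ γ I) {t : ℝ} (ht : t ∈ I) : HasDerivAt γ (f t (γ t)) t :=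
  (h.integralCurve t ht).hasDerivAt (h.isOpen.mem_nhds ht)

/-- Rescaling time turns a solution reaching time `t` into a solution on `[0, 1]` of a problem with
`t` as a parameter. -/
theorem IsSolution.rescale {x₀ : State} {γ : ℝ → State} {I : Set ℝ}
    (h : IsSolution f J D x₀ γ I) {t : ℝ} (ht : t ∈ I) :
    ∀ s ∈ Icc (0 : ℝ) 1, (t * s, γ (t * s)) ∈ J ×ˢ D ∧
      HasDerivAt (fun s => γ (t * s)) (t • Function.uncurry f (t * s, γ (t * s))) s := by
  intro s hs
  have hts : t * s ∈ I := by
    have := h.ordConnected.convex.smul_mem_of_zero_mem h.zero_mem ht hs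
    rwa [smul_eq_mul, mul_comm] at this
  refine ⟨⟨h.subset hts, h.mapsTo hts⟩, ?_⟩
  have h1 : HasDerivAt (fun s : ℝ => t * s) t s := by
    simpa using (hasDerivAt_id s).const_mul t
  exact (h.hasDerivAt hts).scomp s h1

/-- Two solutions of the same initial value problem agree wherever both are defined: after rescaling,
both live on `[0, 1]`. -/
theorem IsSolution.apply_eq (hJ : IsOpen J) (hD : IsOpen D)
    (hf : ContDiffOn ℝ 1 (Function.uncurry f) (J ×ˢ D)) {x₀ : State} {γ γ' : ℝ → State}
    {I I' : Set ℝ} (h : IsSolution f J D x₀ γ I) (h' : IsSolution f J D x₀ γ' I') {t : ℝ}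
    (ht : t ∈ I) (ht' : t ∈ I') : γ t = γ' t := by
  have := eqOn_Icc_of_hasDerivAt_rescaled (hJ.prod hD) hf (h.rescale ht) (h'.rescale ht')
    (by simp [h.initial, h'.initial]) (right_mem_Icc.2 zero_le_one)
  simpa using this

open Classical in
/-- The maximal flow of `ẋ = f (t, x)`, with the value `0` off its domain. -/
noncomputable def flow (f : ℝ → State → State) (J : Set ℝ) (D : Set State) (z : ℝ × State) :
    State :=
  if h : z ∈ flowDomain f J D then h.choose z.1 else 0

theorem IsSolution.flow_eq (hJ : IsOpen J) (hD : IsOpen D)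
    (hf : ContDiffOn ℝ 1 (Function.uncurry f) (J ×ˢ D)) {x₀ : State} {γ : ℝ → State}
    {I : Set ℝ} (h : IsSolution f J D x₀ γ I) {t : ℝ} (ht : t ∈ I) :
    flow f J D (t, x₀) = γ t := by
  have hz : (t, x₀) ∈ flowDomain f J D := ⟨γ, I, h, ht⟩
  rw [flow, dif_pos hz]
  obtain ⟨I', h', ht'⟩ := hz.choose_spec
  exact h'.apply_eq hJ hD hf h ht' ht

theorem IsSolution.of_hasDerivAt_Ioo {x₀ : State} {γ : ℝ → State} {a b : ℝ} (ha : a < 0)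
    (hb : 0 < b) (h0 : γ 0 = x₀)
    (h : ∀ t ∈ Ioo a b, (t, γ t) ∈ J ×ˢ D ∧ HasDerivAt γ (f t (γ t)) t) :
    IsSolution f J D x₀ γ (Ioo a b) where
  isOpen := isOpen_Ioo
  ordConnected := ordConnected_Ioo
  zero_mem := ⟨ha, hb⟩
  subset t ht := (h t ht).1.1
  mapsTo t ht := (h t ht).1.2
  integralCurve t ht := (h t ht).2.hasDerivWithinAt
  initial := h0

theorem zero_mem_flowDomain (hJ : IsOpen J) (hJ0 : (0 : ℝ) ∈ J) (hD : IsOpen D)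
    (hf : ContDiffOn ℝ 1 (Function.uncurry f) (J ×ˢ D)) {x₀ : State} (hx₀ : x₀ ∈ D) :
    ((0 : ℝ), x₀) ∈ flowDomain f J D := by
  -- For the time scale `0`, constant functions solve the rescaled problem on `[-1, 1]`; a solution
  -- for a small time scale `ε > 0` is a solution of the original problem on `(-ε, ε)`.
  obtain ⟨Y, hY, -⟩ := exists_smooth_solution_family (a := -1) (b := 1) (n := 1) (β₀ := 0)
    (γ := fun _ => x₀) (by norm_num) (by norm_num) (hJ.prod hD) le_rfl (by exact_mod_cast hf)
    (fun s _ => by simpa using ⟨hJ0, hx₀⟩)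
    (fun s _ => by simpa using hasDerivAt_const s x₀)
  have hcont : ContinuousAt (fun ε : ℝ => (ε, x₀)) 0 := by fun_prop
  obtain ⟨ε, hε, h0, hs⟩ : ∃ ε : ℝ, 0 < ε ∧ _ :=
    ((hcont.eventually hY).filter_mono nhdsWithin_le_nhds |>.and
      (self_mem_nhdsWithin : ∀ᶠ ε in 𝓝[>] (0 : ℝ), 0 < ε)).exists.imp fun ε h => ⟨h.2, h.1⟩
  refine ⟨fun t => Y (ε, x₀) (ε⁻¹ * t), Ioo (-ε) ε, ?_, by simpa using hε⟩
  refine .of_hasDerivAt_Ioo (by linarith) hε (by simpa using h0) fun t ht => ?_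
  have hmul : ε * (ε⁻¹ * t) = t := by field_simp
  obtain ⟨hΩ, hd⟩ := hs (ε⁻¹ * t) ⟨by
      rw [inv_mul_eq_div, le_div_iff₀ hε]; linarith [ht.1], by
      rw [inv_mul_eq_div, div_le_one hε]; exact ht.2.le⟩
  rw [hmul] at hΩ hd
  refine ⟨hΩ, ?_⟩
  have h1 : HasDerivAt (fun t : ℝ => ε⁻¹ * t) ε⁻¹ t := by
    simpa using (hasDerivAt_id t).const_mul ε⁻¹
  have h2 := hd.scomp t h1
  rwa [smul_smul, inv_mul_cancel₀ hε.ne', one_smul] at h2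

theorem isOpen_flowDomain (hJ : IsOpen J) (hD : IsOpen D)
    (hf : ContDiffOn ℝ 1 (Function.uncurry f) (J ×ˢ D)) : IsOpen (flowDomain f J D) := by
  rw [isOpen_iff_mem_nhds]
  rintro ⟨t, x₀⟩ ⟨γ, I, h, ht⟩
  -- A compact interval in `I` with `0` and `t` in its interior.
  obtain ⟨a, ha, haI⟩ : ∃ a < min 0 t, a ∈ I := by
    have hmin : min 0 t ∈ I := by
      rcases min_choice 0 t with h' | h' <;> rw [h']
      exacts [h.zero_mem, ht]
    obtain ⟨l, u, hlu, hsub⟩ := mem_nhds_iff_exists_Ioo_subset.1 (h.isOpen.mem_nhds hmin)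
    obtain ⟨a, hla, ha⟩ := exists_between hlu.1
    exact ⟨a, ha, hsub ⟨hla, ha.trans hlu.2⟩⟩
  obtain ⟨b, hb, hbI⟩ : ∃ b > max 0 t, b ∈ I := by
    have hmax : max 0 t ∈ I := by
      rcases max_choice 0 t with h' | h' <;> rw [h']
      exacts [h.zero_mem, ht]
    obtain ⟨l, u, hlu, hsub⟩ := mem_nhds_iff_exists_Ioo_subset.1 (h.isOpen.mem_nhds hmax)
    obtain ⟨b, hb, hbu⟩ := exists_between hlu.2
    exact ⟨b, hb, hsub ⟨hlu.1.trans hb, hbu⟩⟩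
  obtain ⟨ha0, hat⟩ := lt_min_iff.1 ha
  obtain ⟨hb0, hbt⟩ := max_lt_iff.1 hb
  have hsub : Icc a b ⊆ I := h.ordConnected.out haI hbI
  obtain ⟨Y, hY, -⟩ := exists_smooth_solution_family (n := 1) (β₀ := 1) (γ := γ) ha0.le hb0.le
    (hJ.prod hD) le_rfl (by exact_mod_cast hf)
    (fun s hs => by simpa using ⟨h.subset (hsub hs), h.mapsTo (hsub hs)⟩)
    (fun s hs => by simpa using h.hasDerivAt (hsub hs))
  rw [h.initial] at hY
  have hcont : ContinuousAt (fun z : ℝ × State => ((1 : ℝ), z.2)) (t, x₀) := by fun_prop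
  have ht' : ∀ᶠ z : ℝ × State in 𝓝 (t, x₀), z.1 ∈ Ioo a b :=
    continuousAt_fst.eventually_mem (Ioo_mem_nhds hat hbt)
  filter_upwards [hcont.eventually hY, ht'] with z hz hzt
  refine ⟨Y (1, z.2), Ioo a b, .of_hasDerivAt_Ioo ha0 hb0 hz.1 fun s hs => ?_, hzt⟩
  simpa using hz.2 s (Ioo_subset_Icc_self hs)

theorem isSolution_flow (hJ : IsOpen J) (hJ0 : (0 : ℝ) ∈ J) (hD : IsOpen D)
    (hf : ContDiffOn ℝ 1 (Function.uncurry f) (J ×ˢ D)) {x₀ : State} (hx₀ : x₀ ∈ D) :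
    IsSolution f J D x₀ (fun t => flow f J D (t, x₀)) {t | (t, x₀) ∈ flowDomain f J D} where
  isOpen := (isOpen_flowDomain hJ hD hf).preimage (by fun_prop)
  ordConnected := by
    refine ⟨?_⟩
    rintro t₁ ⟨γ₁, I₁, h₁, ht₁⟩ t₂ ⟨γ₂, I₂, h₂, ht₂⟩ s hs
    rcases le_total 0 s with h | h
    · exact ⟨γ₂, I₂, h₂, h₂.ordConnected.out h₂.zero_mem ht₂ ⟨h, hs.2⟩⟩
    · exact ⟨γ₁, I₁, h₁, h₁.ordConnected.out ht₁ h₁.zero_mem ⟨hs.1, h⟩⟩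
  zero_mem := zero_mem_flowDomain hJ hJ0 hD hf hx₀
  subset := by
    rintro t ⟨γ, I, h, ht⟩
    exact h.subset ht
  mapsTo := by
    rintro t ⟨γ, I, h, ht⟩
    simpa only [h.flow_eq hJ hD hf ht] using h.mapsTo ht
  integralCurve := by
    rintro t ⟨γ, I, h, ht⟩
    refine HasDerivAt.hasDerivWithinAt ?_
    dsimp only at h ht ⊢
    rw [h.flow_eq hJ hD hf ht]
    refine (h.hasDerivAt ht).congr_of_eventuallyEq ?_
    filter_upwards [h.isOpen.mem_nhds ht] with s hs
    exact h.flow_eq hJ hD hf hs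
  initial := by
    obtain ⟨γ, I, h, h0⟩ := zero_mem_flowDomain hJ hJ0 hD hf hx₀
    rw [h.flow_eq hJ hD hf h0, h.initial]

/-- The flow of a `C^n` equation is jointly `C^n`: by rescaling to `[0, 1]`, its value at `(t, x)` is
the value at `1` of the solution of a problem with parameters `(t, x)`. -/
theorem contDiffOn_flow (hJ : IsOpen J) (hD : IsOpen D) {n : ℕ} (hn : 1 ≤ n)
    (hf : ContDiffOn ℝ n (Function.uncurry f) (J ×ˢ D)) :
    ContDiffOn ℝ n (flow f J D) (flowDomain f J D) := by
  have hf1 : ContDiffOn ℝ 1 (Function.uncurry f) (J ×ˢ D) := hf.of_le (by exact_mod_cast hn)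
  rintro ⟨t, x₀⟩ hz
  refine ContDiffAt.contDiffWithinAt ?_
  have hmem := (isOpen_flowDomain hJ hD hf1).mem_nhds hz
  obtain ⟨γ, I, h, ht⟩ := hz
  obtain ⟨Y, hY, hYsmooth⟩ := exists_smooth_solution_family le_rfl zero_le_one (hJ.prod hD) hn hf
    (fun s hs => (h.rescale ht s hs).1) (fun s hs => (h.rescale ht s hs).2)
  simp only [mul_zero, h.initial] at hY hYsmooth
  refine (hYsmooth 1 (right_mem_Icc.2 zero_le_one)).congr_of_eventuallyEq ?_
  filter_upwards [hY, hmem] with z hz hzmem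
  obtain ⟨γ', I', h', ht'⟩ := hzmem
  have h1 := eqOn_Icc_of_hasDerivAt_rescaled (hJ.prod hD) hf1 (h'.rescale ht') hz.2
    (by simp [h'.initial, hz.1]) (right_mem_Icc.2 zero_le_one)
  exact (h'.flow_eq hJ hD hf1 ht').trans (by simpa using h1)

end Flow

/-! ### Convexity and the Weingarten matrix -/

section Geometry

variable {σ : ℝ × ℝ → Space} {q : ℝ × ℝ}

theorem isUnit_det_frameMatrix (h : crossUV σ q ≠ 0) : IsUnit (frameMatrix σ q).det := by
  rw [det_frameMatrix]
  exact (norm_ne_zero_iff.mpr h).isUnit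

theorem inner_unitNormal_partialU (σ : ℝ × ℝ → Space) (q : ℝ × ℝ) :
    inner ℝ (unitNormal σ q) (partialU σ q) = 0 := by
  simp [PiLp.inner_apply, unitNormal, crossUV, cross_apply, Fin.sum_univ_three]
  ring

theorem inner_unitNormal_partialV (σ : ℝ × ℝ → Space) (q : ℝ × ℝ) :
    inner ℝ (unitNormal σ q) (partialV σ q) = 0 := by
  simp [PiLp.inner_apply, unitNormal, crossUV, cross_apply, Fin.sum_univ_three]
  ring

theorem frameMatrix_mulVec (σ : ℝ × ℝ → Space) (q : ℝ × ℝ) (a : Fin 3 → ℝ) :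
    WithLp.toLp 2 (frameMatrix σ q *ᵥ a) =
      a 0 • partialU σ q + a 1 • partialV σ q + a 2 • unitNormal σ q := by
  ext i
  simp only [Matrix.mulVec, dotProduct, Fin.sum_univ_three, frameMatrix, Matrix.of_apply,
    Matrix.cons_val, PiLp.add_apply, PiLp.smul_apply, smul_eq_mul]
  ring

/-- The third coordinate in the frame `(σ_u, σ_v, n)` is the inner product with `n`. -/
theorem exists_eq_frame_combination (h : crossUV σ q ≠ 0) (y : Space) :
    ∃ a b : ℝ, y = a • partialU σ q + b • partialV σ q +
      inner ℝ (unitNormal σ q) y • unitNormal σ q := by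
  set a := (frameMatrix σ q)⁻¹ *ᵥ y.ofLp with ha
  have hsum : y = a 0 • partialU σ q + a 1 • partialV σ q + a 2 • unitNormal σ q := by
    rw [← frameMatrix_mulVec, ha, Matrix.mulVec_mulVec,
      Matrix.mul_nonsing_inv _ (isUnit_det_frameMatrix h), Matrix.one_mulVec]
  have ha2 : inner ℝ (unitNormal σ q) y = a 2 := by
    conv_lhs => rw [hsum]
    rw [inner_add_right, inner_add_right, inner_smul_right, inner_smul_right, inner_smul_right,
      inner_unitNormal_partialU, inner_unitNormal_partialV, real_inner_self_eq_norm_sq,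
      norm_unitNormal h]
    simp
  exact ⟨a 0, a 1, by rw [ha2]; exact hsum⟩

theorem fderiv_apply_eq_combination {f : ℝ × ℝ → Space} (w : ℝ × ℝ) :
    fderiv ℝ f q w = w.1 • partialU f q + w.2 • partialV f q := by
  rw [partialU, partialV, ← map_smul, ← map_smul, ← map_add]
  simp

/-- The normal pointing into a convex body is a normal of a supporting half-space: a supporting
functional vanishes on the tangent plane, hence is a multiple of the normal. -/
theorem inner_unitNormal_sub_nonneg {K : Set Space} (hK : Convex ℝ K)
    (hKsolid : (interior K).Nonempty) {U : Set (ℝ × ℝ)} (hU : IsOpen U)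
    (hσK : MapsTo σ U (frontier K)) (hKclosed : IsClosed K) (hq : q ∈ U)
    (hσ : DifferentiableAt ℝ σ q) (hreg : crossUV σ q ≠ 0)
    (hin : ∀ᶠ s in 𝓝[>] (0 : ℝ), σ q + s • unitNormal σ q ∈ K) {y : Space} (hy : y ∈ K) :
    0 ≤ inner ℝ (unitNormal σ q) (y - σ q) := by
  obtain ⟨ℓ, hℓ0, hℓ⟩ := geometric_hahn_banach_of_nonempty_interior_point hK (hσK hq).2 hKsolid
  have hmax : IsLocalMax (fun q' => ℓ (σ q')) q := by
    filter_upwards [hU.mem_nhds hq] with q' hq'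
    exact hℓ _ (hKclosed.frontier_subset (hσK hq'))
  have hd : ∀ w, ℓ (fderiv ℝ σ q w) = 0 := fun w =>
    DFunLike.congr_fun (hmax.hasFDerivAt_eq_zero (ℓ.hasFDerivAt.comp q hσ.hasFDerivAt)) w
  have hℓn : ∀ z, ℓ z = inner ℝ (unitNormal σ q) z * ℓ (unitNormal σ q) := by
    intro z
    obtain ⟨a, b, hab⟩ := exists_eq_frame_combination hreg z
    conv_lhs => rw [hab]
    simp [show ℓ (partialU σ q) = 0 from hd _, show ℓ (partialV σ q) = 0 from hd _]
  have hn0 : ℓ (unitNormal σ q) ≠ 0 := by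
    intro h0
    apply hℓ0
    ext z
    simp [hℓn z, h0]
  obtain ⟨s, hs, hs0⟩ := (hin.and self_mem_nhdsWithin).exists
  have hneg : ℓ (unitNormal σ q) < 0 := by
    have h1 := hℓ _ hs
    rw [map_add, map_smul, smul_eq_mul] at h1
    exact lt_of_le_of_ne (nonpos_of_mul_nonpos_right (by linarith) hs0) hn0
  have h1 := hℓ y hy
  rw [← sub_nonpos, ← map_sub, hℓn] at h1
  exact nonneg_of_mul_nonpos_left h1 hneg

/-- A monotonicity inequality passes to the derivatives. -/
theorem inner_fderiv_nonpos {f g : ℝ × ℝ → Space} (hf : DifferentiableAt ℝ f q)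
    (hg : DifferentiableAt ℝ g q)
    (hfg : ∀ᶠ q' in 𝓝 q, inner ℝ (f q' - f q) (g q' - g q) ≤ 0) (w : ℝ × ℝ) :
    inner ℝ (fderiv ℝ f q w) (fderiv ℝ g q w) ≤ 0 := by
  have hline : HasDerivAt (fun t : ℝ => q + t • w) w 0 := by
    simpa using ((hasDerivAt_id (0 : ℝ)).smul_const w).const_add q
  have key : ∀ h : ℝ × ℝ → Space, DifferentiableAt ℝ h q →
      Tendsto (slope (fun t : ℝ => h (q + t • w)) 0) (𝓝[≠] 0) (𝓝 (fderiv ℝ h q w)) := by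
    intro h hh
    rw [← hasDerivAt_iff_tendsto_slope]
    have hh' : HasFDerivAt h (fderiv ℝ h q) (q + (0 : ℝ) • w) := by simpa using hh.hasFDerivAt
    exact hh'.comp_hasDerivAt 0 hline
  refine le_of_tendsto ((key f hf).inner (key g hg)) ?_
  have htend : Tendsto (fun t : ℝ => q + t • w) (𝓝[≠] 0) (𝓝 q) := by
    have := hline.continuousAt.tendsto
    simp only [zero_smul, add_zero] at this
    exact this.mono_left nhdsWithin_le_nhds
  filter_upwards [htend.eventually hfg] with t ht
  simp only [slope, vsub_eq_sub, zero_smul, add_zero, sub_zero, inner_smul_left, inner_smul_right]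
  rw [← mul_assoc]
  exact mul_nonpos_of_nonneg_of_nonpos (mul_self_nonneg t⁻¹) ht

/-- Where `⟨dσ w, dn w⟩ ≤ 0`, the matrix `I - r W` is invertible: a fixed vector `w` of `r W` has
`dσ w = r dn w`, hence `|dσ w|² ≤ 0`. -/
theorem isUnit_det_one_sub_smul_weingarten
    (hreg : ∀ᶠ q' in 𝓝 q, crossUV σ q' ≠ 0) (hn : DifferentiableAt ℝ (unitNormal σ) q)
    (hcurv : ∀ w, inner ℝ (fderiv ℝ σ q w) (fderiv ℝ (unitNormal σ) q w) ≤ 0)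
    {r : ℝ} (hr : 0 ≤ r) : IsUnit (1 - r • weingarten σ q).det := by
  rw [isUnit_iff_ne_zero]
  intro hdet
  obtain ⟨w, hw0, hw⟩ := Matrix.exists_mulVec_eq_zero_iff.2 hdet
  apply hw0
  set W := weingarten σ q
  obtain ⟨hu, hv⟩ := weingarten_eq hreg hn
  -- A vector `w = r W w` satisfies `dσ w = r dn w`.
  have hσn : fderiv ℝ σ q (w 0, w 1) = r • fderiv ℝ (unitNormal σ) q (w 0, w 1) := by
    rw [fderiv_apply_eq_combination, fderiv_apply_eq_combination, hu, hv]
    have h0 := congrFun hw 0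
    have h1 := congrFun hw 1
    simp only [Matrix.mulVec, dotProduct, Fin.sum_univ_two, Matrix.sub_apply, Matrix.one_apply_eq,
      Matrix.smul_apply, smul_eq_mul, Pi.zero_apply] at h0 h1
    rw [Matrix.one_apply_ne (by decide)] at h0 h1
    change w 0 • partialU σ q + w 1 • partialV σ q = r • (w 0 • (W 0 0 • partialU σ q +
      W 1 0 • partialV σ q) + w 1 • (W 0 1 • partialU σ q + W 1 1 • partialV σ q))
    have h0' : w 0 = r * (w 0 * W 0 0 + w 1 * W 0 1) := by linarith
    have h1' : w 1 = r * (w 0 * W 1 0 + w 1 * W 1 1) := by linarith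
    have h01 : w 0 • partialU σ q + w 1 • partialV σ q =
        (r * (w 0 * W 0 0 + w 1 * W 0 1)) • partialU σ q +
          (r * (w 0 * W 1 0 + w 1 * W 1 1)) • partialV σ q := by rw [← h0', ← h1']
    rw [h01]
    module
  have hσ0 : fderiv ℝ σ q (w 0, w 1) = 0 := by
    rw [← real_inner_self_nonpos]
    nth_rw 2 [hσn]
    rw [inner_smul_right]
    exact mul_nonpos_of_nonneg_of_nonpos hr (hcurv _)
  have hvec : frameMatrix σ q *ᵥ ![w 0, w 1, 0] = 0 := by
    have h1 := frameMatrix_mulVec σ q ![w 0, w 1, 0]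
    rw [fderiv_apply_eq_combination] at hσ0
    simp only [Matrix.cons_val, zero_smul, add_zero, hσ0] at h1
    simpa using congrArg WithLp.ofLp h1
  have h2 := Matrix.eq_zero_of_mulVec_eq_zero (isUnit_det_frameMatrix hreg.self_of_nhds).ne_zero hvec
  ext i
  fin_cases i
  · simpa using congrFun h2 0
  · simpa using congrFun h2 1

end Geometry

/-! ### Regularity of the right-hand side -/

section Regularity

variable {X : Type*} [NormedAddCommGroup X] [NormedSpace ℝ X] {m : Type*} [Fintype m]
  {n : WithTop ℕ∞} {S : Set X}

theorem contDiffOn_matrix_mulVec {l : Type*} {A : X → Matrix l m ℝ} {v : X → m → ℝ}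
    (hA : ∀ i j, ContDiffOn ℝ n (fun x => A x i j) S)
    (hv : ∀ j, ContDiffOn ℝ n (fun x => v x j) S) (i : l) :
    ContDiffOn ℝ n (fun x => (A x *ᵥ v x) i) S := by
  simp only [Matrix.mulVec, dotProduct]
  exact ContDiffOn.sum fun j _ => (hA i j).mul (hv j)

variable [DecidableEq m]

theorem contDiffOn_matrix_det {A : X → Matrix m m ℝ}
    (hA : ∀ i j, ContDiffOn ℝ n (fun x => A x i j) S) : ContDiffOn ℝ n (fun x => (A x).det) S := by
  simp only [Matrix.det_apply']
  exact ContDiffOn.sum fun τ _ => contDiffOn_const.mul (contDiffOn_prod fun i _ => hA _ _)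

theorem contDiffOn_matrix_inv {A : X → Matrix m m ℝ}
    (hA : ∀ i j, ContDiffOn ℝ n (fun x => A x i j) S) (hdet : ∀ x ∈ S, IsUnit (A x).det)
    (i j : m) : ContDiffOn ℝ n (fun x => (A x)⁻¹ i j) S := by
  simp only [Matrix.inv_def, Matrix.smul_apply, Ring.inverse_eq_inv', smul_eq_mul,
    Matrix.adjugate_apply]
  refine ((contDiffOn_matrix_det hA).inv fun x hx => (hdet x hx).ne_zero).mul
    (contDiffOn_matrix_det fun k l => ?_)
  by_cases hk : k = j
  · subst hk
    simpa using contDiffOn_const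
  · simpa [Matrix.updateRow_ne hk] using hA k l

end Regularity

section SurfaceRegularity

variable {σ f : ℝ × ℝ → Space} {U : Set (ℝ × ℝ)} {n m : WithTop ℕ∞}

theorem contDiffOn_partialU (hU : IsOpen U) (hf : ContDiffOn ℝ m f U) (hnm : n + 1 ≤ m) :
    ContDiffOn ℝ n (partialU f) U :=
  (hf.fderiv_of_isOpen hU hnm).clm_apply contDiffOn_const

theorem contDiffOn_partialV (hU : IsOpen U) (hf : ContDiffOn ℝ m f U) (hnm : n + 1 ≤ m) :
    ContDiffOn ℝ n (partialV f) U :=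
  (hf.fderiv_of_isOpen hU hnm).clm_apply contDiffOn_const

theorem contDiffOn_crossUV (hU : IsOpen U) (hσ : ContDiffOn ℝ m σ U) (hnm : n + 1 ≤ m) :
    ContDiffOn ℝ n (crossUV σ) U := by
  have hu := contDiffOn_euclidean.1 (contDiffOn_partialU hU hσ hnm)
  have hv := contDiffOn_euclidean.1 (contDiffOn_partialV hU hσ hnm)
  rw [contDiffOn_euclidean]
  intro i
  simp only [crossUV, cross_apply]
  fin_cases i
  · exact ((hu 1).mul (hv 2)).sub ((hu 2).mul (hv 1))
  · exact ((hu 2).mul (hv 0)).sub ((hu 0).mul (hv 2))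
  · exact ((hu 0).mul (hv 1)).sub ((hu 1).mul (hv 0))

theorem contDiffOn_unitNormal (hU : IsOpen U) (hσ : ContDiffOn ℝ m σ U) (hnm : n + 1 ≤ m)
    (hreg : ∀ q ∈ U, crossUV σ q ≠ 0) : ContDiffOn ℝ n (unitNormal σ) U := by
  have h := contDiffOn_crossUV hU hσ hnm
  exact ((h.norm ℝ hreg).inv fun q hq => norm_ne_zero_iff.2 (hreg q hq)).smul h

theorem contDiffOn_frameMatrix (hU : IsOpen U) (hσ : ContDiffOn ℝ m σ U) (hnm : n + 1 ≤ m)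
    (hreg : ∀ q ∈ U, crossUV σ q ≠ 0) (i j : Fin 3) :
    ContDiffOn ℝ n (fun q => frameMatrix σ q i j) U := by
  simp only [frameMatrix, Matrix.of_apply]
  fin_cases j
  · exact contDiffOn_euclidean.1 (contDiffOn_partialU hU hσ hnm) i
  · exact contDiffOn_euclidean.1 (contDiffOn_partialV hU hσ hnm) i
  · exact contDiffOn_euclidean.1 (contDiffOn_unitNormal hU hσ hnm hreg) i

theorem contDiffOn_weingarten (hU : IsOpen U) (hσ : ContDiffOn ℝ m σ U) (hnm : n + 1 + 1 ≤ m)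
    (hreg : ∀ q ∈ U, crossUV σ q ≠ 0) (i j : Fin 2) :
    ContDiffOn ℝ n (fun q => weingarten σ q i j) U := by
  have hn : ContDiffOn ℝ (n + 1) (unitNormal σ) U := contDiffOn_unitNormal hU hσ hnm hreg
  simp only [weingarten, Matrix.of_apply]
  refine contDiffOn_matrix_mulVec (contDiffOn_matrix_inv
    (contDiffOn_frameMatrix hU hσ (le_self_add.trans hnm) hreg)
    fun q hq => isUnit_det_frameMatrix (hreg q hq)) (fun k => ?_) _
  fin_cases j
  · exact contDiffOn_euclidean.1 (contDiffOn_partialU hU hn le_rfl) k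
  · exact contDiffOn_euclidean.1 (contDiffOn_partialV hU hn le_rfl) k

theorem isOpen_phaseSpace (hU : IsOpen U) : IsOpen (phaseSpace U) :=
  (hU.preimage (by fun_prop : Continuous fun x : State => (x 0, x 1))).inter
    (isOpen_lt continuous_const (continuous_apply 2))

theorem contDiffOn_rhs {c : ℝ → Space} {J : Set ℝ} (hJ : IsOpen J) (hU : IsOpen U)
    (hσ : ContDiffOn ℝ (n + 1 + 1) σ U) (hreg : ∀ q ∈ U, crossUV σ q ≠ 0)
    (hc : ContDiffOn ℝ (n + 1) c J)
    (hunit : ∀ q ∈ U, ∀ r : ℝ, 0 < r → IsUnit (1 - r • weingarten σ q).det) :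
    ContDiffOn ℝ n (Function.uncurry (rhs σ c)) (J ×ˢ phaseSpace U) := by
  have hcoord : ∀ i, ContDiffOn ℝ n (fun z : ℝ × State => z.2 i) (J ×ˢ phaseSpace U) :=
    fun i => by fun_prop
  have hpt : ContDiffOn ℝ n (fun z : ℝ × State => (z.2 0, z.2 1)) (J ×ˢ phaseSpace U) :=
    (hcoord 0).prodMk (hcoord 1)
  have hptU : MapsTo (fun z : ℝ × State => (z.2 0, z.2 1)) (J ×ˢ phaseSpace U) U :=
    fun z hz => hz.2.1
  have hc' : ∀ i, ContDiffOn ℝ n (fun z : ℝ × State => deriv c z.1 i) (J ×ˢ phaseSpace U) :=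
    fun i => contDiffOn_euclidean.1 ((hc.deriv_of_isOpen hJ le_rfl).comp contDiffOn_fst
      fun z hz => hz.1) i
  have hframe := contDiffOn_matrix_mulVec (contDiffOn_matrix_inv
    (A := fun z : ℝ × State => frameMatrix σ (z.2 0, z.2 1))
    (fun i j => (contDiffOn_frameMatrix (n := n) hU hσ le_self_add hreg i j).comp hpt hptU)
    fun z hz => isUnit_det_frameMatrix (hreg _ (hptU hz))) hc'
  have hW := contDiffOn_matrix_inv
    (A := fun z : ℝ × State => 1 - z.2 2 • weingarten σ (z.2 0, z.2 1))
    (fun i j => contDiffOn_const.sub ((hcoord 2).mul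
      ((contDiffOn_weingarten hU hσ le_rfl hreg i j).comp hpt hptU)))
    fun z hz => hunit _ (hptU hz) _ hz.2.2
  rw [contDiffOn_pi]
  refine contDiffOn_matrix_mulVec (fun i j => ?_) hframe
  simp only [Matrix.reindex_apply, Matrix.submatrix_apply]
  rcases (finSumFinEquiv (m := 2) (n := 1)).symm i with k | k <;>
    rcases (finSumFinEquiv (m := 2) (n := 1)).symm j with l | l
  · exact hW k l
  · exact contDiffOn_const
  · exact contDiffOn_const
  · exact contDiffOn_const

end SurfaceRegularity

end FlyBy

theorem mainTheorem7
    (p : ℕ) (hp : 1 ≤ p)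
    (K : Set FlyBy.Space) (hKclosed : IsClosed K) (hKconvex : Convex ℝ K)
    (hKsolid : (interior K).Nonempty)
    (U : Set (ℝ × ℝ)) (hU : IsOpen U)
    (σ : ℝ × ℝ → FlyBy.Space) (hσ : ContDiffOn ℝ (p + 2) σ U)
    (hσK : MapsTo σ U (frontier K))
    (hσreg : ∀ q ∈ U, FlyBy.crossUV σ q ≠ 0)
    (hσin : ∀ q ∈ U, ∀ᶠ s in 𝓝[>] (0 : ℝ), σ q + s • FlyBy.unitNormal σ q ∈ K)
    (J : Set ℝ) (hJ : IsOpen J) (hJconn : J.OrdConnected) (hJ0 : (0 : ℝ) ∈ J)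
    (c : ℝ → FlyBy.Space) (hc : ContDiffOn ℝ (p + 1) c J) :
    IsOpen (FlyBy.flowDomain (FlyBy.rhs σ c) J (FlyBy.phaseSpace U)) ∧
    (∀ x₀ ∈ FlyBy.phaseSpace U,
      ((0 : ℝ), x₀) ∈ FlyBy.flowDomain (FlyBy.rhs σ c) J (FlyBy.phaseSpace U)) ∧
    ∃ φ : ℝ × FlyBy.State → FlyBy.State,
      (∀ x₀ ∈ FlyBy.phaseSpace U,
        FlyBy.IsSolution (FlyBy.rhs σ c) J (FlyBy.phaseSpace U) x₀ (fun t => φ (t, x₀))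
          {t | (t, x₀) ∈ FlyBy.flowDomain (FlyBy.rhs σ c) J (FlyBy.phaseSpace U)}) ∧
      (∀ x₀ γ I, FlyBy.IsSolution (FlyBy.rhs σ c) J (FlyBy.phaseSpace U) x₀ γ I →
        EqOn γ (fun t => φ (t, x₀)) I) ∧
      ContDiffOn ℝ p φ (FlyBy.flowDomain (FlyBy.rhs σ c) J (FlyBy.phaseSpace U)) := by
  have hσd : ∀ q ∈ U, DifferentiableAt ℝ σ q := fun q hq =>
    (hσ.contDiffAt (hU.mem_nhds hq)).differentiableAt (by positivity)
  have hσ' : ContDiffOn ℝ ((p : WithTop ℕ∞) + 1 + 1) σ U := by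
    rwa [add_assoc, one_add_one_eq_two]
  have hn1 : ContDiffOn ℝ ((p : WithTop ℕ∞) + 1) (FlyBy.unitNormal σ) U :=
    FlyBy.contDiffOn_unitNormal hU hσ' le_rfl hσreg
  have hnd : ∀ q ∈ U, DifferentiableAt ℝ (FlyBy.unitNormal σ) q := fun q hq =>
    (hn1.contDiffAt (hU.mem_nhds hq)).differentiableAt (by positivity)
  have hsupp : ∀ q ∈ U, ∀ y ∈ K, 0 ≤ inner ℝ (FlyBy.unitNormal σ q) (y - σ q) :=
    fun q hq y hy => FlyBy.inner_unitNormal_sub_nonneg hKconvex hKsolid hU hσK hKclosed hq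
      (hσd q hq) (hσreg q hq) (hσin q hq) hy
  have hmono : ∀ q ∈ U, ∀ q' ∈ U,
      inner ℝ (σ q' - σ q) (FlyBy.unitNormal σ q' - FlyBy.unitNormal σ q) ≤ 0 := by
    intro q hq q' hq'
    have h1 := hsupp q hq _ (hKclosed.frontier_subset (hσK hq'))
    have h2 := hsupp q' hq' _ (hKclosed.frontier_subset (hσK hq))
    rw [real_inner_comm, inner_sub_left]
    rw [← neg_sub, inner_neg_right] at h2
    linarith
  have hunit : ∀ q ∈ U, ∀ r : ℝ, 0 < r → IsUnit (1 - r • FlyBy.weingarten σ q).det := by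
    intro q hq r hr
    have hqU : ∀ᶠ q' in 𝓝 q, q' ∈ U := hU.mem_nhds hq
    exact FlyBy.isUnit_det_one_sub_smul_weingarten (hqU.mono hσreg) (hnd q hq)
      (FlyBy.inner_fderiv_nonpos (hσd q hq) (hnd q hq) (hqU.mono (hmono q hq))) hr.le
  have hf := FlyBy.contDiffOn_rhs hJ hU hσ' hσreg hc hunit
  have hf1 := hf.of_le (m := 1) (by exact_mod_cast hp)
  have hD := FlyBy.isOpen_phaseSpace hU
  exact ⟨FlyBy.isOpen_flowDomain hJ hD hf1,
    fun x₀ hx₀ => FlyBy.zero_mem_flowDomain hJ hJ0 hD hf1 hx₀,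
    FlyBy.flow _ J (FlyBy.phaseSpace U),
    fun x₀ hx₀ => FlyBy.isSolution_flow hJ hJ0 hD hf1 hx₀,
    fun x₀ γ I h t ht => (h.flow_eq hJ hD hf1 ht).symm,
    FlyBy.contDiffOn_flow hJ hD hp hf⟩
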